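/- Let $X$ be a complex Banach space and $T\in L(X)$ a bounded linear operator; write $N(S)$, $\mathcal R(S)$ for the kernel and range of an operator $S$. The ascent (descent) of $S$ is the least $n\ge 0$ with $N(S^n)=N(S^{n+1})$ (respectively $\mathcal R(S^n)=\mathcal R(S^{n+1})$), and $\infty$ if there is no such $n$. A bounded operator $S$ on a normed space is upper semi-Fredholm if $\mathcal R(S)$ is closed and $\dim N(S)<\infty$. An operator $S\in L(X)$ is upper semi-B-Fredholm if for some integer $n\ge 0$ the space $\mathcal R(S^n)$ is closed and the restriction $S_{[n]}:\mathcal R(S^n)\to\mathcal R(S^n)$ of $S$ is upper semi-Fredholm. Let $\sigma(T)$ be the spectrum of $T$, let $\sigma_a(T)$ be the set of $\lambda\in\mathbb C$ such that $T-\lambda I$ is not bounded below, and let $\sigma_{uf}(T)$ and $\sigma_{ubf}(T)$ be the sets of $\lambda\in\mathbb C$ such that $T-\lambda I$ is not upper semi-Fredholm, respectively not upper semi-B-Fredholm. Put $$\Delta_{uf}(T)=\sigma_a(T)\setminus\sigma_{uf}(T),\qquad \Delta^g_{uf}(T)=\sigma_a(T)\setminus\sigma_{ubf}(T).$$ Let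 $p_0(T)$ be the set of poles of $T$, that is, of $\lambda\in\sigma(T)$ such that $T-\lambda I$ has finite ascent and finite descent. Let $p_0^a(T)$ be the set of left poles of $T$, that is, of $\lambda\in\sigma_a(T)$ such that $T-\lambda I$ has finite ascent $p$ and $\mathcal R((T-\lambda I)^{p+1})$ is closed. Let $p_{00}(T)$ and $p_{00}^a(T)$ be the sets of poles, respectively left poles, $\lambda$ of finite rank, i.e. with $\dim N(T-\lambda I)<\infty$. We say that $T$ satisfies property $(bz)$ if $\Delta_{uf}(T)=p_{00}^a(T)$; property $(gbz)$ if $\Delta_{uf}^g(T)=p_0^a(T)$; property $(bz_1)$ if $\Delta_{uf}(T)=p_{00}(T)$; and property $(gbz_1)$ if $\Delta_{uf}^g(T)=p_0(T)$. Then the following hold for every $T\in L(X)$. (i) $T$ satisfies property $(bz_1)$ if and only if $T$ satisfies property $(bz)$ and $p_{00}(T)=p_{00}^a(T)$. (ii) $T$ satisfies property $(gbz_1)$ if and only if $T$ satisfies property $(gbz)$ and $p_0(T)=p_0^a(T)$. -/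

import Mathlib

namespace BFredholm

variable {E : Type*} [NormedAddCommGroup E] [NormedSpace ℂ E]

/-- `T` is bounded below: `c * ‖x‖ ≤ ‖T x‖` for all `x`, with some constant `c > 0`. -/
def IsBoundedBelow (T : E →L[ℂ] E) : Prop :=
  ∃ c : ℝ, 0 < c ∧ ∀ x : E, c * ‖x‖ ≤ ‖T x‖

/-- `T` is upper semi-Fredholm: its range is closed and its kernel is finite-dimensional. -/
def IsUpperSemiFredholm (T : E →L[ℂ] E) : Prop :=
  IsClosed (T.range : Set E) ∧ FiniteDimensional ℂ T.ker

theorem mapsTo_range_pow (T : E →L[ℂ] E) (n : ℕ) :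
    ∀ x ∈ (T ^ n).range, T x ∈ (T ^ n).range := by
  rintro _ ⟨y, rfl⟩
  refine ⟨T y, ?_⟩
  change (T ^ n * T) y = (T * T ^ n) y
  rw [← pow_succ, ← pow_succ']

/-- The operator `T_[n]`: the restriction of `T` to the range of `T ^ n`, viewed as an operator
from that space into itself. -/
def restrictRangePow (T : E →L[ℂ] E) (n : ℕ) : (T ^ n).range →L[ℂ] (T ^ n).range :=
  T.restrict (mapsTo_range_pow T n)

/-- `T` is upper semi-B-Fredholm: for some `n`, the range of `T ^ n` is closed and `T_[n]` is an
upper semi-Fredholm operator. -/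
def IsUpperSemiBFredholm (T : E →L[ℂ] E) : Prop :=
  ∃ n : ℕ, IsClosed ((T ^ n).range : Set E) ∧ IsUpperSemiFredholm (restrictRangePow T n)

/-- The ascent: the least `n` with `ker T ^ n = ker T ^ (n + 1)`, and `⊤` if there is none. -/
noncomputable def ascent (T : E →L[ℂ] E) : ℕ∞ :=
  ⨅ (n : ℕ) (_ : (T ^ n).ker = (T ^ (n + 1)).ker), (n : ℕ∞)

/-- The descent: the least `n` with `range T ^ n = range T ^ (n + 1)`, and `⊤` if there is none. -/
noncomputable def descent (T : E →L[ℂ] E) : ℕ∞ :=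
  ⨅ (n : ℕ) (_ : (T ^ n).range = (T ^ (n + 1)).range), (n : ℕ∞)

/-- `T` is Drazin invertible: it has finite ascent and finite descent. -/
def IsDrazinInvertible (T : E →L[ℂ] E) : Prop :=
  ascent T ≠ ⊤ ∧ descent T ≠ ⊤

/-- `T` is left Drazin invertible: its ascent `p` is finite and the range of `T ^ (p + 1)` is
closed. -/
def IsLeftDrazinInvertible (T : E →L[ℂ] E) : Prop :=
  ∃ p : ℕ, ascent T = p ∧ IsClosed ((T ^ (p + 1)).range : Set E)

/-- The operator `T - lam * I`. -/
noncomputable def shift (T : E →L[ℂ] E) (lam : ℂ) : E →L[ℂ] E :=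
  T - lam • ContinuousLinearMap.id ℂ E

/-- The approximate point spectrum `σ_a(T)`. -/
def approxPointSpectrum (T : E →L[ℂ] E) : Set ℂ :=
  {lam | ¬ IsBoundedBelow (shift T lam)}

/-- The upper semi-Fredholm spectrum `σ_uf(T)`. -/
def upperSemiFredholmSpectrum (T : E →L[ℂ] E) : Set ℂ :=
  {lam | ¬ IsUpperSemiFredholm (shift T lam)}

/-- The upper semi-B-Fredholm spectrum `σ_ubf(T)`. -/
def upperSemiBFredholmSpectrum (T : E →L[ℂ] E) : Set ℂ :=
  {lam | ¬ IsUpperSemiBFredholm (shift T lam)}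

/-- `Δ_uf(T) = σ_a(T) \ σ_uf(T)`. -/
def deltaUF (T : E →L[ℂ] E) : Set ℂ :=
  approxPointSpectrum T \ upperSemiFredholmSpectrum T

/-- `Δ_uf^g(T) = σ_a(T) \ σ_ubf(T)`. -/
def deltaUFg (T : E →L[ℂ] E) : Set ℂ :=
  approxPointSpectrum T \ upperSemiBFredholmSpectrum T

/-- The poles of `T`: points `lam` of the spectrum with `T - lam * I` Drazin invertible. -/
def poles (T : E →L[ℂ] E) : Set ℂ :=
  {lam | lam ∈ spectrum ℂ T ∧ IsDrazinInvertible (shift T lam)}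

/-- The poles of finite rank: poles `lam` with `ker (T - lam * I)` finite-dimensional. -/
def polesFiniteRank (T : E →L[ℂ] E) : Set ℂ :=
  {lam | lam ∈ poles T ∧ FiniteDimensional ℂ (shift T lam).ker}

/-- The left poles of `T`: points `lam` of the approximate point spectrum with `T - lam * I` left
Drazin invertible. -/
def leftPoles (T : E →L[ℂ] E) : Set ℂ :=
  {lam | lam ∈ approxPointSpectrum T ∧ IsLeftDrazinInvertible (shift T lam)}

/-- The left poles of finite rank: left poles `lam` with `ker (T - lam * I)` finite-dimensional. -/
def leftPolesFiniteRank (T : E →L[ℂ] E) : Set ℂ :=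
  {lam | lam ∈ leftPoles T ∧ FiniteDimensional ℂ (shift T lam).ker}

/-- Property `(bz)`. -/
def PropertyBz (T : E →L[ℂ] E) : Prop := deltaUF T = leftPolesFiniteRank T

/-- Property `(gbz)`. -/
def PropertyGbz (T : E →L[ℂ] E) : Prop := deltaUFg T = leftPoles T

/-- Property `(bz1)`. -/
def PropertyBz1 (T : E →L[ℂ] E) : Prop := deltaUF T = polesFiniteRank T

/-- Property `(gbz1)`. -/
def PropertyGbz1 (T : E →L[ℂ] E) : Prop := deltaUFg T = poles T

end BFredholm

/-! Both parts follow from a chain `P ⊆ L ⊆ D` (poles, left poles, Δ-set): `D = P` squeezes `L`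
between equal sets. The work lies in closed ranges. By the open mapping theorem, an operator range
is closed once its sum with a closed subspace disjoint from it is closed. For poles this sum is the
whole space; for left poles it is a preimage of the closed range of `S ^ (p + 1)`. -/

namespace BFredholm

/-! ### Closed operator ranges via closed complements -/

section ClosedRange

variable {E F : Type*} [NormedAddCommGroup E] [NormedSpace ℂ E] [CompleteSpace E]
  [NormedAddCommGroup F] [NormedSpace ℂ F] [CompleteSpace F]

/-- The range of a bounded operator is closed if it has a closed algebraic complement in some
closed subspace. -/
theorem isClosed_range_of_disjoint_of_isClosed_sup (A : E →L[ℂ] F) (G : Submodule ℂ F)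
    (hG : IsClosed (G : Set F)) (hdisj : Disjoint A.range G)
    (hsup : IsClosed ((A.range ⊔ G : Submodule ℂ F) : Set F)) :
    IsClosed (A.range : Set F) := by
  have : CompleteSpace G := hG.completeSpace_coe
  have : CompleteSpace (A.range ⊔ G : Submodule ℂ F) := hsup.completeSpace_coe
  have hmem : ∀ q : E × G, (A.coprod G.subtypeL) q ∈ A.range ⊔ G := fun q ↦
    Submodule.add_mem_sup ⟨q.1, rfl⟩ q.2.2
  let Φ : E × G →L[ℂ] (A.range ⊔ G : Submodule ℂ F) := (A.coprod G.subtypeL).codRestrict _ hmem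
  have hΦ : ∀ q : E × G, ((Φ q : (A.range ⊔ G : Submodule ℂ F)) : F) = A q.1 + q.2 := fun _ ↦ rfl
  have hsurj : Function.Surjective Φ := by
    rintro ⟨y, hy⟩
    obtain ⟨_, ⟨x, rfl⟩, g, hg, rfl⟩ := Submodule.mem_sup.1 hy
    exact ⟨(x, ⟨g, hg⟩), Subtype.ext rfl⟩
  -- `Φ` is a surjection of Banach spaces, hence a quotient map, so closedness can be tested on the
  -- preimage, which is `E × {0}` by disjointness.
  have hpre : IsClosed (Φ ⁻¹' (Subtype.val ⁻¹' (A.range : Set F))) := by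
    have : Φ ⁻¹' (Subtype.val ⁻¹' (A.range : Set F)) = Prod.snd ⁻¹' {(0 : G)} := by
      ext ⟨x, g⟩
      simp only [Set.mem_preimage, hΦ, SetLike.mem_coe, Set.mem_singleton_iff]
      constructor
      · intro h
        have hg : (g : F) ∈ A.range := by
          simpa using A.range.sub_mem h (⟨x, rfl⟩ : A x ∈ A.range)
        exact Subtype.ext (Submodule.disjoint_def.1 hdisj _ hg g.2)
      · rintro rfl
        exact ⟨x, by simp⟩
    rw [this]
    exact isClosed_singleton.preimage continuous_snd
  have hcl := (Φ.isQuotientMap hsurj).isClosed_preimage.1 hpre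
  have := hsup.isClosedEmbedding_subtypeVal.isClosedMap _ hcl
  convert this using 1
  ext y
  refine ⟨fun hy ↦ ⟨⟨y, Submodule.mem_sup_left hy⟩, hy, rfl⟩, ?_⟩
  rintro ⟨w, hw, rfl⟩
  exact hw

/-- Replacing `N` by a complement of `A.range ⊓ N` in `N` gives disjointness without changing the
sum. -/
theorem isClosed_range_of_isClosed_sup_finiteDimensional (A : E →L[ℂ] F) (N : Submodule ℂ F)
    [FiniteDimensional ℂ N] (hsup : IsClosed ((A.range ⊔ N : Submodule ℂ F) : Set F)) :
    IsClosed (A.range : Set F) := by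
  obtain ⟨G, hdisj, hG⟩ := IsModularLattice.exists_disjoint_and_sup_eq (inf_le_right : A.range ⊓ N ≤ N)
  have hGN : G ≤ N := hG ▸ le_sup_right
  have : FiniteDimensional ℂ G := Submodule.finiteDimensional_of_le hGN
  refine isClosed_range_of_disjoint_of_isClosed_sup A G G.closed_of_finiteDimensional ?_ ?_
  · rw [Submodule.disjoint_def] at hdisj ⊢
    exact fun x hx hxG ↦ hdisj x ⟨hx, hGN hxG⟩ hxG
  · have : A.range ⊔ G = A.range ⊔ N := by
      rw [← hG, ← sup_assoc, sup_inf_self]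
    rwa [this]

end ClosedRange

/-! ### Kernels and ranges of powers -/

section Chains

variable {E : Type*} [NormedAddCommGroup E] [NormedSpace ℂ E]

theorem pow_add_apply (S : E →L[ℂ] E) (m n : ℕ) (x : E) :
    (S ^ (m + n)) x = (S ^ m) ((S ^ n) x) := by
  rw [pow_add]
  rfl

theorem exists_ker_pow_eq_of_ascent_ne_top {S : E →L[ℂ] E} (h : ascent S ≠ ⊤) :
    ∃ p : ℕ, ascent S = p ∧ (S ^ p).ker = (S ^ (p + 1)).ker := by
  classical
  have hex : ∃ n : ℕ, (S ^ n).ker = (S ^ (n + 1)).ker := by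
    by_contra! hne
    exact h (iInf₂_eq_top.2 fun n hn ↦ (hne n hn).elim)
  refine ⟨Nat.find hex, le_antisymm (iInf₂_le (Nat.find hex) (Nat.find_spec hex)) ?_, Nat.find_spec hex⟩
  exact le_iInf₂ fun n hn ↦ by exact_mod_cast Nat.find_min' hex hn

theorem exists_range_pow_eq_of_descent_ne_top {S : E →L[ℂ] E} (h : descent S ≠ ⊤) :
    ∃ q : ℕ, (S ^ q).range = (S ^ (q + 1)).range := by
  by_contra! hne
  exact h (iInf₂_eq_top.2 fun n hn ↦ (hne n hn).elim)

theorem pow_apply_eq_zero_of_ker_pow_eq {S : E →L[ℂ] E} {p : ℕ}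
    (h : (S ^ p).ker = (S ^ (p + 1)).ker) (k : ℕ) {x : E} (hx : (S ^ (p + k)) x = 0) :
    (S ^ p) x = 0 := by
  induction k generalizing x with
  | zero => exact hx
  | succ k ih =>
    rw [show p + (k + 1) = (p + 1) + k by ring, pow_add_apply] at hx
    have hx' : (S ^ k) x ∈ (S ^ p).ker := h ▸ hx
    refine ih ?_
    rw [pow_add_apply]
    exact hx'

theorem range_pow_le_of_range_pow_eq {S : E →L[ℂ] E} {q : ℕ}
    (h : (S ^ q).range = (S ^ (q + 1)).range) (k : ℕ) :
    (S ^ q).range ≤ (S ^ (q + k)).range := by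
  induction k with
  | zero => exact le_rfl
  | succ k ih =>
    intro x hx
    obtain ⟨y, rfl⟩ := ih hx
    obtain ⟨z, hz⟩ : (S ^ q) y ∈ (S ^ (q + 1)).range := h ▸ ⟨y, rfl⟩
    refine ⟨z, ?_⟩
    change (S ^ (q + (k + 1))) z = (S ^ (q + k)) y
    change (S ^ (q + 1)) z = (S ^ q) y at hz
    rw [show q + (k + 1) = k + (q + 1) by ring, add_comm q k, pow_add_apply, hz, pow_add_apply]

/-- Transfers closedness from the range of a higher power to a sum, by continuity of `S ^ m`. -/
theorem comap_pow_range_pow_add (S : E →L[ℂ] E) (m n : ℕ) :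
    Submodule.comap (S ^ m : E →L[ℂ] E).toLinearMap (S ^ (m + n)).range =
      (S ^ n).range ⊔ (S ^ m).ker := by
  rw [← Submodule.comap_map_eq, ← LinearMap.range_comp, pow_add]
  rfl

theorem disjoint_range_pow_ker_pow {S : E →L[ℂ] E} {p : ℕ}
    (h : (S ^ p).ker = (S ^ (p + 1)).ker) (k : ℕ) : Disjoint (S ^ p).range (S ^ k).ker := by
  rw [Submodule.disjoint_def]
  rintro _ ⟨y, rfl⟩ hx
  refine pow_apply_eq_zero_of_ker_pow_eq h k ?_
  rw [add_comm, pow_add_apply]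
  exact hx

theorem finiteDimensional_ker_pow (S : E →L[ℂ] E) [FiniteDimensional ℂ S.ker] (n : ℕ) :
    FiniteDimensional ℂ (S ^ n).ker := by
  induction n with
  | zero =>
    have : (S ^ 0).ker = ⊥ := LinearMap.ker_id
    rw [this]
    infer_instance
  | succ n ih =>
    have : (S ^ (n + 1)).ker = Submodule.comap S.toLinearMap (S ^ n).ker := by
      rw [pow_succ]
      rfl
    rw [this]
    infer_instance

theorem ker_eq_bot_of_isBoundedBelow {S : E →L[ℂ] E} (h : IsBoundedBelow S) : S.ker = ⊥ := by
  obtain ⟨c, hc, hb⟩ := h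
  refine (Submodule.eq_bot_iff _).2 fun x hx ↦ ?_
  have h0 : S x = 0 := hx
  have := hb x
  rw [h0, norm_zero] at this
  exact norm_eq_zero.1 (le_antisymm (nonpos_of_mul_nonpos_right this hc) (norm_nonneg x))

end Chains

/-! ### Consequences of Drazin and left Drazin invertibility -/

section Drazin

variable {E : Type*} [NormedAddCommGroup E] [NormedSpace ℂ E] [CompleteSpace E] {S : E →L[ℂ] E}

theorem IsDrazinInvertible.isLeftDrazinInvertible (h : IsDrazinInvertible S) :
    IsLeftDrazinInvertible S := by
  obtain ⟨p, hp, hker⟩ := exists_ker_pow_eq_of_ascent_ne_top h.1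
  obtain ⟨q, hq⟩ := exists_range_pow_eq_of_descent_ne_top h.2
  -- The ranges stabilise already at the ascent `p`: descent gives the equation after applying `S ^
  -- q`, and stability of kernels cancels `S ^ q`.
  have hstep : ∀ k y, ∃ z, (S ^ p) y = (S ^ (p + k)) z := by
    intro k y
    obtain ⟨z, hz⟩ : (S ^ q) ((S ^ p) y) ∈ (S ^ (q + (p + k))).range :=
      range_pow_le_of_range_pow_eq hq _ ⟨_, rfl⟩
    change (S ^ (q + (p + k))) z = (S ^ q) ((S ^ p) y) at hz
    have h0 : (S ^ p) (y - (S ^ k) z) = 0 := by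
      refine pow_apply_eq_zero_of_ker_pow_eq hker q ?_
      rw [add_comm, pow_add_apply, map_sub, map_sub, ← hz, ← pow_add_apply, ← pow_add_apply,
        add_assoc, sub_self]
    rw [map_sub, sub_eq_zero, ← pow_add_apply] at h0
    exact ⟨z, h0⟩
  refine ⟨p, hp, isClosed_range_of_disjoint_of_isClosed_sup _ (S ^ p).ker (S ^ p).isClosed_ker
    ?_ ?_⟩
  · refine (disjoint_range_pow_ker_pow hker p).mono_left ?_
    rintro _ ⟨y, rfl⟩
    exact ⟨S y, by rw [pow_succ]; rfl⟩
  · have : (S ^ (p + 1)).range ⊔ (S ^ p).ker = ⊤ := by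
      refine Submodule.eq_top_iff'.2 fun x ↦ ?_
      obtain ⟨z, hz⟩ := hstep (p + 1) x
      refine Submodule.mem_sup.2 ⟨(S ^ (p + 1)) z, ⟨z, rfl⟩, x - (S ^ (p + 1)) z, ?_, by abel⟩
      change (S ^ p) (x - (S ^ (p + 1)) z) = 0
      rw [map_sub, hz, ← pow_add_apply, sub_self]
    rw [this]
    exact isClosed_univ

theorem IsDrazinInvertible.isUnit_of_isBoundedBelow (h : IsDrazinInvertible S)
    (hb : IsBoundedBelow S) : IsUnit S := by
  have hinj : Function.Injective S := LinearMap.ker_eq_bot.1 (ker_eq_bot_of_isBoundedBelow hb)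
  refine ContinuousLinearMap.isUnit_iff_bijective.2 ⟨hinj, fun x ↦ ?_⟩
  -- Injectivity cancels `S ^ q` in `S ^ q x = S ^ (q + 1) z`, leaving `x = S z`.
  obtain ⟨q, hq⟩ := exists_range_pow_eq_of_descent_ne_top h.2
  obtain ⟨z, hz⟩ : (S ^ q) x ∈ (S ^ (q + 1)).range := hq ▸ ⟨x, rfl⟩
  have hinjq : Function.Injective (S ^ q) := by
    have : ⇑(S ^ q) = S^[q] := by simp
    rw [this]
    exact hinj.iterate q
  exact ⟨z, hinjq (by rw [← hz, pow_succ]; rfl)⟩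

theorem IsLeftDrazinInvertible.isUpperSemiBFredholm (h : IsLeftDrazinInvertible S) :
    IsUpperSemiBFredholm S := by
  obtain ⟨p, hp, hcl⟩ := h
  obtain ⟨p', hp', hker⟩ := exists_ker_pow_eq_of_ascent_ne_top (S := S) (by simp [hp])
  obtain rfl : p = p' := by exact_mod_cast hp.symm.trans hp'
  -- This makes `S_[p]` injective, and also yields closedness of the range of `S ^ p`, whose sum
  -- with `S.ker` is the preimage under `S` of the range of `S ^ (p + 1)`.
  have hdisj : Disjoint (S ^ p).range S.ker := by
    simpa using disjoint_range_pow_ker_pow hker 1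
  have hclp : IsClosed ((S ^ p).range : Set E) := by
    refine isClosed_range_of_disjoint_of_isClosed_sup _ S.ker S.isClosed_ker hdisj ?_
    have := comap_pow_range_pow_add S 1 p
    rw [pow_one, add_comm] at this
    rw [← this]
    exact hcl.preimage S.continuous
  refine ⟨p, hclp, ?_, ?_⟩
  · have : ((restrictRangePow S p).range : Set (S ^ p).range) =
        Subtype.val ⁻¹' ((S ^ (p + 1)).range : Set E) := by
      ext ⟨x, hx⟩
      constructor
      · rintro ⟨⟨_, y, rfl⟩, hy⟩
        refine ⟨y, ?_⟩
        rw [pow_succ']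
        exact congrArg Subtype.val hy
      · rintro ⟨y, hy⟩
        refine ⟨⟨(S ^ p) y, y, rfl⟩, Subtype.ext ?_⟩
        rw [pow_succ'] at hy
        exact hy
    rw [this]
    exact hcl.preimage continuous_subtype_val
  · have : (restrictRangePow S p).ker = ⊥ := by
      refine (Submodule.eq_bot_iff _).2 fun x hx ↦ Subtype.ext ?_
      exact Submodule.disjoint_def.1 hdisj x x.2 (congrArg Subtype.val hx)
    rw [this]
    infer_instance

/-- Pulling the range of `S ^ (p + 1)` back along `S ^ p` shows `S.range ⊔ (S ^ p).ker` closed, and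
the kernel summand is finite-dimensional. -/
theorem IsLeftDrazinInvertible.isUpperSemiFredholm (h : IsLeftDrazinInvertible S)
    (hfin : FiniteDimensional ℂ S.ker) : IsUpperSemiFredholm S := by
  obtain ⟨p, -, hcl⟩ := h
  have := finiteDimensional_ker_pow S p
  refine ⟨isClosed_range_of_isClosed_sup_finiteDimensional S (S ^ p).ker ?_, hfin⟩
  have hcomap := comap_pow_range_pow_add S p 1
  rw [pow_one] at hcomap
  rw [← hcomap]
  exact hcl.preimage (S ^ p).continuous

end Drazin

/-! ### The chain of inclusions -/

section Inclusions

variable {E : Type*} [NormedAddCommGroup E] [NormedSpace ℂ E] [CompleteSpace E] (T : E →L[ℂ] E)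

theorem poles_subset_leftPoles : poles T ⊆ leftPoles T := by
  rintro lam ⟨hspec, hD⟩
  refine ⟨fun hb ↦ hspec ?_, hD.isLeftDrazinInvertible⟩
  have h : algebraMap ℂ (E →L[ℂ] E) lam - T = -shift T lam := by
    rw [shift, neg_sub, Algebra.algebraMap_eq_smul_one]
    rfl
  change IsUnit (algebraMap ℂ (E →L[ℂ] E) lam - T)
  rw [h]
  exact (hD.isUnit_of_isBoundedBelow hb).neg

theorem leftPoles_subset_deltaUFg : leftPoles T ⊆ deltaUFg T :=
  fun _ h ↦ ⟨h.1, not_not.2 h.2.isUpperSemiBFredholm⟩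

theorem polesFiniteRank_subset_leftPolesFiniteRank :
    polesFiniteRank T ⊆ leftPolesFiniteRank T :=
  fun _ h ↦ ⟨poles_subset_leftPoles T h.1, h.2⟩

theorem leftPolesFiniteRank_subset_deltaUF : leftPolesFiniteRank T ⊆ deltaUF T :=
  fun _ h ↦ ⟨h.1.1, not_not.2 (h.1.2.isUpperSemiFredholm h.2)⟩

end Inclusions

theorem eq_iff_eq_and_eq_of_subset {α : Type*} {P L D : Set α} (hPL : P ⊆ L) (hLD : L ⊆ D) :
    D = P ↔ D = L ∧ P = L := by
  refine ⟨?_, fun h ↦ h.1.trans h.2.symm⟩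
  rintro rfl
  have h := hPL.antisymm hLD
  exact ⟨h, h⟩

end BFredholm

theorem mainTheorem5 {X : Type*} [NormedAddCommGroup X] [NormedSpace ℂ X] [CompleteSpace X]
    (T : X →L[ℂ] X) :
    (BFredholm.PropertyBz1 T ↔
      BFredholm.PropertyBz T ∧
        BFredholm.polesFiniteRank T = BFredholm.leftPolesFiniteRank T) ∧
    (BFredholm.PropertyGbz1 T ↔
      BFredholm.PropertyGbz T ∧ BFredholm.poles T = BFredholm.leftPoles T) :=
  ⟨BFredholm.eq_iff_eq_and_eq_of_subset (BFredholm.polesFiniteRank_subset_leftPolesFiniteRank T)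
      (BFredholm.leftPolesFiniteRank_subset_deltaUF T),
    BFredholm.eq_iff_eq_and_eq_of_subset (BFredholm.poles_subset_leftPoles T)
      (BFredholm.leftPoles_subset_deltaUFg T)⟩
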